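/- Theorem 4. There is an absolute constant $C>0$ such that the following holds. Let $K\ge 1$, $p_1,\dots,p_K\ge 1$, $p=\sum_{k=1}^K p_k$, and let $n\ge p_k$ for every $k$. Let $A\in\mathbb{R}^{n\times p}$ be a random matrix whose rows are i.i.d. copies of a zero-mean sub-gaussian random vector $a\in\mathbb{R}^p$ with covariance matrix $\Sigma=\mathbb{E}[aa^{\mathrm T}]\succ 0$; here a real random variable $z$ is called sub-gaussian if $\mathbb{E}[e^{z^2/L^2}]\le 2$ for some $L>0$, its sub-gaussian norm is $\|z\|_{\psi_2}=\inf\{L>0:\mathbb{E}[e^{z^2/L^2}]\le 2\}$, and a random vector is sub-gaussian if all its one-dimensional marginals $a^{\mathrm T}h$ are. Partition the columns as $A=[A_1,\dots,A_K]$ with $A_k\in\mathbb{R}^{n\times p_k}$ and $a=[a_1;\dots;a_K]$ accordingly, let $\Sigma_k\in\mathbb{R}^{p_k\times p_k}$ be the $k$-th diagonal block of $\Sigma$, let $A_k^+$ be the Moore–Penrose pseudoinverse of $A_k$, and put $$B=I_p-\tfrac1K\bar A A,\qquad \bar A=\begin{bmatrix}A_1^+\\ \vdots\\ A_K^+\end{bmatrix}.$$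 Let $q_k\ge 0$ and let $L_k\ge 1$ be such that $\|h^{\mathrm T}a_k\|_{\psi_2}\le L_k\sqrt{h^{\mathrm T}\Sigma_k h}$ for all $h\in\mathbb{R}^{p_k}$, $k=1,\dots,K$. Set $$\ell_k(q_k)=C L_k^2\left(\sqrt{\tfrac{p_k+q_k}{n}}+\tfrac{p_k+q_k}{n}\right) n\,\sigma_{\max}(\Sigma_k)$$ and $$\beta_{S_c}=1+\frac1K\sqrt{K+\sum_{k=1}^K\ \sum_{\substack{i=1\\ i\ne k}}^K\frac{n\sigma_{\max}(\Sigma_k)+\ell_k(q_k)}{\bigl(n\sigma_{\min}(\Sigma_i)-\ell_i(q_i)\bigr)_+}},$$ where $\sigma_{\max},\sigma_{\min}$ are the largest and smallest singular values, $(x)_+=\max\{0,x\}$, and a quotient with denominator $0$ is read as $+\infty$ (so that then $\beta_{S_c}=+\infty$). Then, with $\|\cdot\|$ the spectral norm, the bound $\|B\|\le\beta_{S_c}$ holds with probability at least $1-\sum_{k=1}^K 2e^{-q_k}$. -/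

import Mathlib

open MeasureTheory ProbabilityTheory
open scoped ENNReal Matrix Matrix.Norms.L2Operator

noncomputable section

/-! ### Moore-Penrose pseudoinverse -/

/-- The four Penrose equations for a real matrix. -/
def IsMoorePenrose {m n : Type*} [Fintype m] [Fintype n]
    (A : Matrix m n ℝ) (X : Matrix n m ℝ) : Prop :=
  A * X * A = A ∧ X * A * X = X ∧ (A * X)ᵀ = A * X ∧ (X * A)ᵀ = X * A

theorem exists_isMoorePenrose {m n : Type*} [Fintype m] [Fintype n]
    (A : Matrix m n ℝ) : ∃ X, IsMoorePenrose A X := by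
  classical
  have hH : (Aᵀ * A).IsHermitian := by
    have := Matrix.isHermitian_conjTranspose_mul_self A
    rwa [Matrix.conjTranspose_eq_transpose_of_trivial] at this
  obtain ⟨H, hHdef⟩ : ∃ H, H = Aᵀ * A := ⟨_, rfl⟩
  rw [← hHdef] at hH
  have hsa : IsSelfAdjoint H := hH
  have hfin : (spectrum ℝ H).Finite := Matrix.finite_real_spectrum
  have hc : ∀ f : ℝ → ℝ, ContinuousOn f (spectrum ℝ H) := fun f => by
    have : Finite (spectrum ℝ H) := hfin
    exact continuousOn_iff_continuous_domRestrict.2 continuous_of_discreteTopology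
  obtain ⟨G, hGdef⟩ : ∃ G, G = cfc (fun x : ℝ => x⁻¹) H := ⟨_, rfl⟩
  have hid : cfc (fun x : ℝ => x) H = H := cfc_id' ℝ H
  have hcomm : H * G = G * H := by
    rw [hGdef]
    nth_rewrite 1 [← hid]
    nth_rewrite 4 [← hid]
    rw [← cfc_mul _ _ H (hc _) (hc _), ← cfc_mul _ _ H (hc _) (hc _)]
    simp only [mul_comm]
  have hHGH : H * G * H = H := by
    have h : cfc (fun x : ℝ => x * x⁻¹ * x) H = H * G * H := by
      rw [cfc_mul _ _ H (hc _) (hc _), cfc_mul _ _ H (hc _) (hc _), hid, ← hGdef]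
    rw [← h]
    simp only [mul_inv_mul_cancel]
    exact hid
  have hGHG : G * H * G = G := by
    have h : cfc (fun x : ℝ => x⁻¹ * x * x⁻¹) H = G * H * G := by
      rw [cfc_mul _ _ H (hc _) (hc _), cfc_mul _ _ H (hc _) (hc _), hid, ← hGdef]
    rw [← h, hGdef]
    congr 1
    funext x
    by_cases hx : x = 0
    · simp [hx]
    · field_simp
  have hGs : Gᵀ = G := by
    have : IsSelfAdjoint G := by rw [hGdef]; exact cfc_predicate _ _
    have h2 : Gᴴ = G := this
    rwa [Matrix.conjTranspose_eq_transpose_of_trivial] at h2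
  have hHs : Hᵀ = H := by
    rw [hHdef, Matrix.transpose_mul, Matrix.transpose_transpose]
  have hGHs : (G * H)ᵀ = G * H := by rw [Matrix.transpose_mul, hGs, hHs, hcomm]
  have key : A * (G * H) = A := by
    have e : Aᵀ * (A * (G * H) - A) = 0 := by
      rw [Matrix.mul_sub, ← Matrix.mul_assoc, ← hHdef, ← Matrix.mul_assoc, hHGH, sub_self]
    have h0 : (A * (G * H) - A)ᴴ * (A * (G * H) - A) = 0 := by
      rw [Matrix.conjTranspose_eq_transpose_of_trivial, Matrix.transpose_sub,
        Matrix.transpose_mul, hGHs, Matrix.sub_mul, Matrix.mul_assoc, e, Matrix.mul_zero, sub_self]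
    have := Matrix.conjTranspose_mul_self_eq_zero.1 h0
    exact sub_eq_zero.1 this
  refine ⟨G * Aᵀ, ?_, ?_, ?_, ?_⟩
  · rw [Matrix.mul_assoc, Matrix.mul_assoc, ← hHdef, key]
  · rw [Matrix.mul_assoc G, ← hHdef, ← Matrix.mul_assoc, hGHG]
  · simp only [Matrix.transpose_mul, Matrix.transpose_transpose, hGs, Matrix.mul_assoc]
  · rw [Matrix.mul_assoc, ← hHdef, hGHs]

theorem IsMoorePenrose.unique {m n : Type*} [Fintype m] [Fintype n]
    {A : Matrix m n ℝ} {X Y : Matrix n m ℝ}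
    (hX : IsMoorePenrose A X) (hY : IsMoorePenrose A Y) : X = Y := by
  obtain ⟨x1, x2, x3, x4⟩ := hX
  obtain ⟨y1, y2, y3, y4⟩ := hY
  have h1 : A * X = A * Y := by
    calc A * X = (A * X)ᵀ := x3.symm
      _ = ((A * Y) * (A * X))ᵀ := by rw [← Matrix.mul_assoc, y1]
      _ = (A * X) * (A * Y) := by rw [Matrix.transpose_mul, x3, y3]
      _ = A * Y := by rw [← Matrix.mul_assoc, x1]
  have h2 : X * A = Y * A := by
    calc X * A = (X * A)ᵀ := x4.symm
      _ = ((X * A) * (Y * A))ᵀ := by rw [Matrix.mul_assoc X, ← Matrix.mul_assoc A, y1]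
      _ = (Y * A) * (X * A) := by rw [Matrix.transpose_mul, x4, y4]
      _ = Y * A := by rw [Matrix.mul_assoc Y, ← Matrix.mul_assoc A, x1]
  calc X = X * A * X := x2.symm
    _ = Y * A * Y := by rw [h2, Matrix.mul_assoc, h1, ← Matrix.mul_assoc]
    _ = Y := y2

/-- The Moore-Penrose pseudoinverse: the unique solution of the Penrose equations. -/
def pinv {m n : Type*} [Fintype m] [Fintype n] (A : Matrix m n ℝ) : Matrix n m ℝ :=
  (exists_isMoorePenrose A).choose

theorem pinv_spec {m n : Type*} [Fintype m] [Fintype n] (A : Matrix m n ℝ) :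
    IsMoorePenrose A (pinv A) :=
  (exists_isMoorePenrose A).choose_spec

/-! ### Extreme singular values -/

/-- The largest singular value of a matrix. -/
def sigmaMax {m n : ℕ} (M : Matrix (Fin m) (Fin n) ℝ) : ℝ :=
  (Matrix.toEuclideanLin M).singularValues 0

/-- The smallest of the `min m n` singular values of an `m × n` matrix (`m, n ≥ 1`). Mathlib lists
the singular values in decreasing order, starting with index `0`. -/
def sigmaMin {m n : ℕ} (M : Matrix (Fin m) (Fin n) ℝ) : ℝ :=
  (Matrix.toEuclideanLin M).singularValues (min m n - 1)

/-! ### Sub-gaussian variables and vectors -/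

section SubGaussian

variable {Ω : Type*} [MeasurableSpace Ω]

/-- `L > 0` and `E[exp (z² / L²)] ≤ 2`; the expectation of this positive variable is taken in
`[0, ∞]`. -/
def PsiTwoBound (z : Ω → ℝ) (μ : Measure Ω) (L : ℝ) : Prop :=
  0 < L ∧ ∫⁻ ω, ENNReal.ofReal (Real.exp (z ω ^ 2 / L ^ 2)) ∂μ ≤ 2

/-- Sub-gaussian random variables. -/
def IsSubGaussianVar (z : Ω → ℝ) (μ : Measure Ω) : Prop :=
  AEMeasurable z μ ∧ ∃ L : ℝ, PsiTwoBound z μ L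

/-- The sub-gaussian norm `‖z‖_{ψ₂}`. -/
def psiTwoNorm (z : Ω → ℝ) (μ : Measure Ω) : ℝ :=
  sInf {L : ℝ | PsiTwoBound z μ L}

/-- The random vector `a` is sub-gaussian (all its one-dimensional marginals are sub-gaussian),
has mean zero, and has covariance matrix `S = E[a aᵀ]`. -/
structure IsCenteredSubGaussianVec {ι : Type*} [Fintype ι] (a : Ω → ι → ℝ)
    (S : Matrix ι ι ℝ) (μ : Measure Ω) : Prop where
  subGaussian : ∀ h : ι → ℝ, IsSubGaussianVar (fun ω => a ω ⬝ᵥ h) μ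
  mean_zero : ∀ j, ∫ ω, a ω j ∂μ = 0
  covariance : ∀ j l, ∫ ω, a ω j * a ω l ∂μ = S j l

end SubGaussian

/-! ### Column partition and the iteration matrix -/

/-- Column indices of `A = [A₁, …, A_K]`, where `A_k` has `p k` columns: the pair `⟨k, j⟩` is the
`j`-th column of the `k`-th block. -/
abbrev BlockIdx {K : ℕ} (p : Fin K → ℕ) : Type := (k : Fin K) × Fin (p k)

/-- The submatrix `A_k` consisting of the columns in the `k`-th block. -/
def colBlock {n K : ℕ} {p : Fin K → ℕ} (A : Matrix (Fin n) (BlockIdx p) ℝ) (k : Fin K) :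
    Matrix (Fin n) (Fin (p k)) ℝ :=
  A.submatrix id (fun j => ⟨k, j⟩)

/-- The `k`-th diagonal block `Σ_k` (principal submatrix) of a square matrix. -/
def diagBlock {K : ℕ} {p : Fin K → ℕ} (S : Matrix (BlockIdx p) (BlockIdx p) ℝ) (k : Fin K) :
    Matrix (Fin (p k)) (Fin (p k)) ℝ :=
  S.submatrix (fun j => ⟨k, j⟩) (fun j => ⟨k, j⟩)

/-- The matrix `Ā = [A₁⁺; …; A_K⁺]`, the pseudoinverses of the blocks stacked row-wise. -/
def stackedPinv {n K : ℕ} {p : Fin K → ℕ} (A : Matrix (Fin n) (BlockIdx p) ℝ) :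
    Matrix (BlockIdx p) (Fin n) ℝ :=
  Matrix.of fun r i => pinv (colBlock A r.1) r.2 i

/-- The matrix `B = I - (1/K) Ā A`. -/
def iterMatrix {n K : ℕ} {p : Fin K → ℕ} (A : Matrix (Fin n) (BlockIdx p) ℝ) :
    Matrix (BlockIdx p) (BlockIdx p) ℝ :=
  1 - (1 / (K : ℝ)) • (stackedPinv A * A)

/-! ### The bound -/

/-- `ℓ_k(q_k) = C L_k² (√((p_k + q_k)/n) + (p_k + q_k)/n) n σ_max(Σ_k)`. -/
def ellBlock (C : ℝ) (n : ℕ) {K : ℕ} {p : Fin K → ℕ} (S : Matrix (BlockIdx p) (BlockIdx p) ℝ)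
    (L q : Fin K → ℝ) (k : Fin K) : ℝ :=
  C * L k ^ 2 * (√(((p k : ℝ) + q k) / n) + ((p k : ℝ) + q k) / n)
    * (n * sigmaMax (diagBlock S k))

/-- The bound `1 + (1/K) √(K + ∑_{k ≠ i} (n σ_max(Σ_k) + ℓ_k) / (n σ_min(Σ_i) - ℓ_i)₊)` as an element
of `[0, ∞]`: a (positive) numerator divided by a vanishing denominator gives `∞`. -/
def betaBound (C : ℝ) (n : ℕ) {K : ℕ} {p : Fin K → ℕ} (S : Matrix (BlockIdx p) (BlockIdx p) ℝ)
    (L q : Fin K → ℝ) : ℝ≥0∞ :=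
  1 + 1 / (K : ℝ≥0∞) *
    ((K : ℝ≥0∞) + ∑ k : Fin K, ∑ i ∈ Finset.univ.filter (fun i : Fin K => i ≠ k),
      ENNReal.ofReal (n * sigmaMax (diagBlock S k) + ellBlock C n S L q k) /
        ENNReal.ofReal (max 0 (n * sigmaMin (diagBlock S i) - ellBlock C n S L q i)))
      ^ (1 / 2 : ℝ)

end

/-! ### A Bernstein inequality -/

/-! The `(i, k)` block of `Ā A` is `A_i⁺ A_k`. Diagonal blocks are orthogonal projections, of norm
at most 1. An off-diagonal block satisfies `‖A_i⁺ A_k‖² ≤ ‖A_i⁺‖² ‖A_k‖²`, and both factors are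
controlled by the quadratic forms of the Gram matrices `A_kᵀ A_k`. A spectral norm is at most the
Frobenius norm of the array of block norms, so `‖B‖ ≤ 1 + ‖Ā A‖ / K` has the required shape
(`ofReal_norm_iterMatrix_le`).

The probabilistic input is that `A_kᵀ A_k` lies within `ℓ_k` of `n Σ_k` as a quadratic form, outside
an event of probability at most `2 exp (-q_k)` (`measureReal_gram_deviation_le`). For a fixed
direction this is Bernstein's inequality for squares of sub-gaussian variables
(`bernstein_two_sided`). A net of at most `25 ^ p_k` points extends it to all directions
(`LinearMap.IsSymmetric.abs_inner_le_of_net`). A union bound over the blocks finishes the proof. -/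

theorem exp_le_one_add_add_sq_mul_exp_abs (t : ℝ) :
    Real.exp t ≤ 1 + t + t ^ 2 * Real.exp |t| := by
  have h := Complex.norm_exp_sub_sum_le_norm_mul_exp (t : ℂ) 2
  have e : Complex.exp t - ∑ m ∈ Finset.range 2, (t : ℂ) ^ m / (m.factorial : ℂ)
      = ((Real.exp t - (1 + t) : ℝ) : ℂ) := by
    simp [Finset.sum_range_succ]
  rw [e, Complex.norm_real, Complex.norm_real, Real.norm_eq_abs, Real.norm_eq_abs, sq_abs] at h
  linarith [le_abs_self (Real.exp t - (1 + t))]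

/-- Half of the exponent `y` dominates `exp |l * y|`; the other half absorbs the factor `y ^ 2`. -/
theorem exp_mul_le_of_nonneg {l y : ℝ} (hl : |l| ≤ 1 / 2) (hy : 0 ≤ y) :
    Real.exp (l * y) ≤ 1 + l * y + 8 * l ^ 2 * Real.exp y := by
  have h1 := exp_le_one_add_add_sq_mul_exp_abs (l * y)
  have h2 : y ^ 2 ≤ 8 * Real.exp (y / 2) := by
    have := Real.quadratic_le_exp_of_nonneg (div_nonneg hy zero_le_two)
    nlinarith
  have h3 : Real.exp |l * y| ≤ Real.exp (y / 2) := by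
    rw [abs_mul, abs_of_nonneg hy]
    exact Real.exp_le_exp.2 (by nlinarith)
  have h4 : y ^ 2 * Real.exp |l * y| ≤ 8 * Real.exp y := by
    calc y ^ 2 * Real.exp |l * y| ≤ (8 * Real.exp (y / 2)) * Real.exp (y / 2) := by gcongr
      _ = 8 * Real.exp y := by rw [mul_assoc, ← Real.exp_add, add_halves]
  nlinarith [mul_le_mul_of_nonneg_left h4 (sq_nonneg l)]

section Bernstein

variable {Ω : Type*} [MeasurableSpace Ω] {μ : Measure Ω}

theorem integrable_exp_of_lintegral_le_two {Y : Ω → ℝ} (hY : AEMeasurable Y μ)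
    (h2 : ∫⁻ ω, ENNReal.ofReal (Real.exp (Y ω)) ∂μ ≤ 2) :
    Integrable (fun ω => Real.exp (Y ω)) μ :=
  ⟨hY.exp.aestronglyMeasurable, by
    rw [hasFiniteIntegral_iff_ofReal (ae_of_all _ fun _ => (Real.exp_pos _).le)]
    exact h2.trans_lt (by simp)⟩

theorem integral_exp_le_two {Y : Ω → ℝ} (hY : AEMeasurable Y μ)
    (h2 : ∫⁻ ω, ENNReal.ofReal (Real.exp (Y ω)) ∂μ ≤ 2) :
    ∫ ω, Real.exp (Y ω) ∂μ ≤ 2 := by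
  have h := ofReal_integral_eq_lintegral_ofReal (integrable_exp_of_lintegral_le_two hY h2)
    (ae_of_all _ fun _ => (Real.exp_pos _).le)
  rw [← h] at h2
  exact (ENNReal.ofReal_le_ofReal_iff zero_le_two).1 (by simpa using h2)

theorem integrable_of_lintegral_exp_le_two {Y : Ω → ℝ} (hY : AEMeasurable Y μ)
    (h0 : ∀ ω, 0 ≤ Y ω) (h2 : ∫⁻ ω, ENNReal.ofReal (Real.exp (Y ω)) ∂μ ≤ 2) :
    Integrable Y μ :=
  (integrable_exp_of_lintegral_le_two hY h2).mono hY.aestronglyMeasurable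
    (ae_of_all _ fun ω => by
      rw [Real.norm_of_nonneg (h0 ω), Real.norm_of_nonneg (Real.exp_pos _).le]
      linarith [Real.add_one_le_exp (Y ω)])

theorem integrable_exp_mul_of_lintegral_exp_le_two {Y : Ω → ℝ} (hY : AEMeasurable Y μ)
    (h0 : ∀ ω, 0 ≤ Y ω) (h2 : ∫⁻ ω, ENNReal.ofReal (Real.exp (Y ω)) ∂μ ≤ 2)
    {l : ℝ} (hl : |l| ≤ 1 / 2) : Integrable (fun ω => Real.exp (l * Y ω)) μ :=
  (integrable_exp_of_lintegral_le_two hY h2).mono (hY.const_mul l).exp.aestronglyMeasurable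
    (ae_of_all _ fun ω => by
      rw [Real.norm_of_nonneg (Real.exp_pos _).le, Real.norm_of_nonneg (Real.exp_pos _).le]
      exact Real.exp_le_exp.2 (by nlinarith [h0 ω, le_abs_self l]))

variable [IsProbabilityMeasure μ]

theorem mgf_le_of_lintegral_exp_le_two {Y : Ω → ℝ} (hY : AEMeasurable Y μ)
    (h0 : ∀ ω, 0 ≤ Y ω) (h2 : ∫⁻ ω, ENNReal.ofReal (Real.exp (Y ω)) ∂μ ≤ 2)
    {l : ℝ} (hl : |l| ≤ 1 / 2) :
    mgf Y μ l ≤ Real.exp (l * ∫ ω, Y ω ∂μ + 16 * l ^ 2) := by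
  have iY := integrable_of_lintegral_exp_le_two hY h0 h2
  have iE := integrable_exp_of_lintegral_le_two hY h2
  have i1 : Integrable (fun ω => 1 + l * Y ω) μ := (integrable_const 1).add (iY.const_mul l)
  have i2 : Integrable (fun ω => 8 * l ^ 2 * Real.exp (Y ω)) μ := iE.const_mul _
  calc mgf Y μ l = ∫ ω, Real.exp (l * Y ω) ∂μ := rfl
    _ ≤ ∫ ω, (1 + l * Y ω + 8 * l ^ 2 * Real.exp (Y ω)) ∂μ :=
        integral_mono (integrable_exp_mul_of_lintegral_exp_le_two hY h0 h2 hl) (i1.add i2)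
          fun ω => exp_mul_le_of_nonneg hl (h0 ω)
    _ = 1 + l * ∫ ω, Y ω ∂μ + 8 * l ^ 2 * ∫ ω, Real.exp (Y ω) ∂μ := by
        rw [integral_add i1 i2, integral_add (integrable_const 1) (iY.const_mul l),
          integral_const_mul, integral_const_mul]
        simp
    _ ≤ (l * ∫ ω, Y ω ∂μ + 16 * l ^ 2) + 1 := by
        nlinarith [mul_le_mul_of_nonneg_left (integral_exp_le_two hY h2) (sq_nonneg l)]
    _ ≤ _ := Real.add_one_le_exp _

theorem bernstein_two_sided {n : ℕ} {Y : Fin n → Ω → ℝ}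
    (hind : iIndepFun Y μ) (hY : ∀ i, AEMeasurable (Y i) μ) (h0 : ∀ i ω, 0 ≤ Y i ω)
    (h2 : ∀ i, ∫⁻ ω, ENNReal.ofReal (Real.exp (Y i ω)) ∂μ ≤ 2) {u : ℝ} (hu : 0 ≤ u) :
    μ.real {ω | 16 * n * (√u + u) ≤ |∑ i, Y i ω - ∑ i, ∫ ω', Y i ω' ∂μ|}
      ≤ 2 * Real.exp (-(4 * (n * u))) := by
  set m : ℝ := ∑ i, ∫ ω', Y i ω' ∂μ with hm
  set t : ℝ := 16 * n * (√u + u) with ht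
  have hsum : ∀ l : ℝ, |l| ≤ 1 / 2 →
      Integrable (fun ω => Real.exp (l * (∑ i, Y i) ω)) μ ∧
      mgf (∑ i, Y i) μ l ≤ Real.exp (l * m + 16 * n * l ^ 2) := by
    intro l hl
    have hmg : mgf (∑ i, Y i) μ l = ∏ i, mgf (Y i) μ l := hind.mgf_sum₀ hY _
    refine ⟨?_, ?_⟩
    -- The mgf of a non-integrable exponential is 0 by convention, but here it is a product of
    -- positive mgfs.
    · by_contra hni
      have hz : mgf (∑ i, Y i) μ l = 0 := mgf_undef hni
      rw [hmg] at hz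
      obtain ⟨i, -, hi⟩ := Finset.prod_eq_zero_iff.1 hz
      exact (mgf_pos (integrable_exp_mul_of_lintegral_exp_le_two (hY i) (h0 i) (h2 i) hl)).ne' hi
    · rw [hmg]
      calc ∏ i, mgf (Y i) μ l ≤ ∏ i, Real.exp (l * ∫ ω, Y i ω ∂μ + 16 * l ^ 2) :=
            Finset.prod_le_prod (fun i _ => mgf_nonneg)
              fun i _ => mgf_le_of_lintegral_exp_le_two (hY i) (h0 i) (h2 i) hl
        _ = _ := by
            rw [← Real.exp_sum, Finset.sum_add_distrib, ← Finset.mul_sum]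
            congr 1
            simp
            ring
  -- The Chernoff parameter is `min (√u) 1 / 2`: it follows `√u` in the gaussian regime and stops at
  -- the largest value the mgf bound allows.
  obtain ⟨l, hl0, hl1, hl2⟩ : ∃ l : ℝ, 0 ≤ l ∧ l ≤ 1 / 2 ∧
      -(l * t) + 16 * n * l ^ 2 ≤ -(4 * (n * u)) := by
    have hs := Real.sqrt_nonneg u
    have hsq := Real.sq_sqrt hu
    have hn : (0 : ℝ) ≤ n := n.cast_nonneg
    rcases le_total (√u) 1 with h | h
    · refine ⟨√u / 2, by positivity, by linarith, ?_⟩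
      have : 0 ≤ n * (√u * u) := by positivity
      have e : (√u / 2) ^ 2 = u / 4 := by rw [div_pow, hsq]; norm_num
      have e2 : √u / 2 * t = 8 * (n * u) + 8 * (n * (√u * u)) := by
        rw [ht]; linear_combination (8 * (n : ℝ)) * hsq
      rw [e, e2]
      linarith
    · refine ⟨1 / 2, by norm_num, le_rfl, ?_⟩
      have h1 : (1 : ℝ) ≤ u := by nlinarith
      have h3 : (0 : ℝ) ≤ n * √u := by positivity
      have h4 : (n : ℝ) ≤ n * u := le_mul_of_one_le_right hn h1
      rw [ht]
      nlinarith
  have habs : |l| ≤ 1 / 2 := by rw [abs_of_nonneg hl0]; exact hl1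
  have habs' : |-l| ≤ 1 / 2 := by rwa [abs_neg]
  have up : μ.real {ω | m + t ≤ (∑ i, Y i) ω} ≤ Real.exp (-(4 * (n * u))) := by
    refine (measure_ge_le_exp_mul_mgf (m + t) hl0 (hsum l habs).1).trans ?_
    refine (mul_le_mul_of_nonneg_left (hsum l habs).2 (Real.exp_pos _).le).trans ?_
    rw [← Real.exp_add]
    exact Real.exp_le_exp.2 (by linarith)
  have lo : μ.real {ω | (∑ i, Y i) ω ≤ m - t} ≤ Real.exp (-(4 * (n * u))) := by
    refine (measure_le_le_exp_mul_mgf (m - t) (neg_nonpos.2 hl0) (hsum (-l) habs').1).trans ?_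
    refine (mul_le_mul_of_nonneg_left (hsum (-l) habs').2 (Real.exp_pos _).le).trans ?_
    rw [← Real.exp_add]
    exact Real.exp_le_exp.2 (by nlinarith)
  have hsub : {ω | t ≤ |∑ i, Y i ω - m|} ⊆
      {ω | m + t ≤ (∑ i, Y i) ω} ∪ {ω | (∑ i, Y i) ω ≤ m - t} := by
    intro ω hω
    simp only [Set.mem_ofPred_eq, Set.mem_union, Finset.sum_apply] at hω ⊢
    rcases le_abs.1 hω with h | h
    · left; linarith
    · right; linarith
  calc _ ≤ μ.real _ := measureReal_mono hsub
    _ ≤ _ := measureReal_union_le _ _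
    _ ≤ _ := by linarith

end Bernstein

/-! ### The sub-gaussian norm -/

section PsiTwo

variable {Ω : Type*} [MeasurableSpace Ω] {μ : Measure Ω}

theorem PsiTwoBound.mono {z : Ω → ℝ} {r s : ℝ} (h : PsiTwoBound z μ r) (hrs : r ≤ s) :
    PsiTwoBound z μ s := by
  have hr := h.1
  refine ⟨hr.trans_le hrs, le_trans (lintegral_mono fun ω => ?_) h.2⟩
  gcongr

/-- The strict inequality avoids having to show that the infimum is attained. -/
theorem IsSubGaussianVar.psiTwoBound_of_norm_lt {z : Ω → ℝ} {r : ℝ} (hz : IsSubGaussianVar z μ)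
    (hr : psiTwoNorm z μ < r) : PsiTwoBound z μ r := by
  obtain ⟨s, hs, hsr⟩ := exists_lt_of_csInf_lt hz.2 hr
  exact PsiTwoBound.mono hs hsr.le

end PsiTwo

/-! ### Nets of the unit ball and quadratic forms -/

section Net

variable {E : Type*} [NormedAddCommGroup E] [NormedSpace ℝ E] [FiniteDimensional ℝ E]

/-- A 1/2-separated subset of maximal cardinality is a net. Doubled, it becomes 1-separated in the
ball of radius 2, where the volume bound gives `5 ^ d`; this bound also makes the maximum exist. -/
theorem exists_half_net_unitBall :
    ∃ N : Finset E, N.card ≤ 5 ^ Module.finrank ℝ E ∧ (∀ c ∈ N, ‖c‖ ≤ 1) ∧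
      ∀ x : E, ‖x‖ ≤ 1 → ∃ c ∈ N, ‖x - c‖ ≤ 1 / 2 := by
  classical
  let P : ℕ → Prop := fun m => ∃ s : Finset E, s.card = m ∧ (∀ c ∈ s, ‖c‖ ≤ 1) ∧
    ∀ c ∈ s, ∀ d ∈ s, c ≠ d → 1 / 2 ≤ ‖c - d‖
  have hP : ∀ m, P m → m ≤ 5 ^ Module.finrank ℝ E := by
    rintro m ⟨s, rfl, h1, h2⟩
    have hinj : Function.Injective fun c : E => (2 : ℝ) • c := smul_right_injective E two_ne_zero
    rw [← Finset.card_image_of_injective s hinj]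
    apply Besicovitch.card_le_of_separated
    · intro _ hc'
      obtain ⟨c, hc, rfl⟩ := Finset.mem_image.1 hc'
      rw [norm_smul, Real.norm_two]
      linarith [h1 c hc]
    · intro _ hc' _ hd' hcd
      obtain ⟨c, hc, rfl⟩ := Finset.mem_image.1 hc'
      obtain ⟨d, hd, rfl⟩ := Finset.mem_image.1 hd'
      have := h2 c hc d hd fun h => hcd (by rw [h])
      rw [← smul_sub, norm_smul, Real.norm_two]
      linarith
  have h0 : P 0 := ⟨∅, by simp⟩
  obtain ⟨s, hs, h1, h2⟩ := Nat.findGreatest_spec (P := P) (Nat.zero_le (5 ^ Module.finrank ℝ E)) h0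
  refine ⟨s, hP _ ⟨s, rfl, h1, h2⟩, h1, fun x hx => ?_⟩
  by_contra! hfar
  have hxs : x ∉ s := fun h => by
    have := hfar x h
    rw [sub_self, norm_zero] at this
    linarith
  have hP' : P (s.card + 1) := by
    refine ⟨insert x s, Finset.card_insert_of_notMem hxs, ?_, ?_⟩
    · intro c hc
      rcases Finset.mem_insert.1 hc with rfl | hc
      exacts [hx, h1 c hc]
    · intro c hc' d hd' hcd
      rcases Finset.mem_insert.1 hc' with rfl | hc <;> rcases Finset.mem_insert.1 hd' with rfl | hd
      · exact absurd rfl hcd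
      · exact (hfar d hd).le
      · rw [norm_sub_rev]; exact (hfar c hc).le
      · exact h2 c hc d hd hcd
  have := Nat.le_findGreatest (hP _ hP') hP'
  omega

/-- The half net is used twice: for `x`, then for the doubled residual `2 (x - c)`. Cardinalities
multiply, and the points `c + d / 2` may leave the unit ball, hence `3 / 2`. -/
theorem exists_quarter_net_unitBall :
    ∃ N : Finset E, N.card ≤ 25 ^ Module.finrank ℝ E ∧ (∀ c ∈ N, ‖c‖ ≤ 3 / 2) ∧
      ∀ x : E, ‖x‖ ≤ 1 → ∃ c ∈ N, ‖x - c‖ ≤ 1 / 4 := by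
  classical
  obtain ⟨N, hN, h1, h2⟩ := exists_half_net_unitBall (E := E)
  refine ⟨Finset.image₂ (fun c d => c + (1 / 2 : ℝ) • d) N N, ?_, ?_, ?_⟩
  · calc _ ≤ N.card * N.card := Finset.card_image₂_le _ _ _
      _ ≤ 5 ^ Module.finrank ℝ E * 5 ^ Module.finrank ℝ E := Nat.mul_le_mul hN hN
      _ = _ := by rw [← mul_pow]; norm_num
  · intro _ hc'
    obtain ⟨c, hc, d, hd, rfl⟩ := Finset.mem_image₂.1 hc'
    have := norm_add_le c ((1 / 2 : ℝ) • d)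
    rw [norm_smul, Real.norm_of_nonneg (by norm_num)] at this
    linarith [h1 c hc, h1 d hd]
  · intro x hx
    obtain ⟨c, hc, hxc⟩ := h2 x hx
    obtain ⟨d, hd, hxd⟩ := h2 ((2 : ℝ) • (x - c)) (by
      rw [norm_smul, Real.norm_two]; linarith)
    refine ⟨_, Finset.mem_image₂_of_mem hc hd, ?_⟩
    have e : x - (c + (1 / 2 : ℝ) • d) = (1 / 2 : ℝ) • ((2 : ℝ) • (x - c) - d) := by
      rw [smul_sub, smul_smul]
      norm_num
      abel
    rw [e, norm_smul, Real.norm_of_nonneg (by norm_num)]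
    linarith

end Net

section QuadraticForm

variable {E : Type*} [NormedAddCommGroup E] [InnerProductSpace ℝ E]

/-- By symmetry `⟪Tx, x⟫ - ⟪Tc, c⟫ = ⟪T(x - c), x + c⟫`, at most `(1/4)(9/4)‖T‖` on the unit sphere.
Since `‖T‖` is the supremum of the Rayleigh quotients, `‖T‖ ≤ δ + (9/16)‖T‖`, whence `16/7`. -/
theorem LinearMap.IsSymmetric.abs_inner_le_of_net [FiniteDimensional ℝ E] {T : E →ₗ[ℝ] E}
    (hT : T.IsSymmetric) {N : Finset E}
    (hcov : ∀ x : E, ‖x‖ ≤ 1 → ∃ c ∈ N, ‖x - c‖ ≤ 1 / 4) {δ : ℝ}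
    (hδ : ∀ c ∈ N, |inner ℝ (T c) c| ≤ δ) (x : E) :
    |inner ℝ (T x) x| ≤ 16 / 7 * δ * ‖x‖ ^ 2 := by
  set S : E →L[ℝ] E := LinearMap.toContinuousLinearMap T with hS
  have hSapp : ∀ x, S x = T x := fun x => rfl
  have hδ0 : 0 ≤ δ := by
    obtain ⟨c, hc, -⟩ := hcov 0 (by simp)
    exact (abs_nonneg _).trans (hδ c hc)
  have hunit : ∀ x : E, ‖x‖ = 1 → |inner ℝ (T x) x| ≤ δ + 9 / 16 * ‖S‖ := by
    intro x hx
    obtain ⟨c, hc, hxc⟩ := hcov x hx.le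
    have hcn : ‖x + c‖ ≤ 9 / 4 := by
      have e : x + c = (2 : ℝ) • x - (x - c) := by rw [two_smul]; abel
      have := norm_sub_le ((2 : ℝ) • x) (x - c)
      rw [← e, norm_smul, Real.norm_two, hx] at this
      linarith
    have e : inner ℝ (T x) x = inner ℝ (T c) c + inner ℝ (S (x - c)) (x + c) := by
      have := hT x c
      have h2 := real_inner_comm (T c) x
      rw [hSapp, map_sub, inner_sub_left, inner_add_right, inner_add_right]
      linarith
    have hb : |inner ℝ (S (x - c)) (x + c)| ≤ 9 / 16 * ‖S‖ := by
      calc _ ≤ ‖S (x - c)‖ * ‖x + c‖ := abs_real_inner_le_norm _ _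
        _ ≤ (‖S‖ * (1 / 4)) * (9 / 4) := by
            gcongr
            exact (S.le_opNorm _).trans (by gcongr)
        _ = _ := by ring
    rw [e]
    exact (abs_add_le _ _).trans (add_le_add (hδ c hc) hb)
  have hray : ∀ x : E, |S.rayleighQuotient x| ≤ δ + 9 / 16 * ‖S‖ := by
    intro x
    rcases eq_or_ne x 0 with rfl | hx
    · simp only [ContinuousLinearMap.rayleighQuotient_apply_zero, abs_zero]
      positivity
    · have hx' : ‖x‖ ≠ 0 := norm_ne_zero_iff.2 hx
      rw [← S.rayleigh_smul x (c := ‖x‖⁻¹) (inv_ne_zero hx')]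
      have hn : ‖‖x‖⁻¹ • x‖ = 1 := by
        rw [norm_smul, norm_inv, norm_norm, inv_mul_cancel₀ hx']
      have h := hunit _ hn
      rw [ContinuousLinearMap.rayleighQuotient, hn, one_pow, div_one,
        ContinuousLinearMap.reApplyInnerSelf_apply]
      simpa [hSapp] using h
  have hnorm : ‖S‖ ≤ δ + 9 / 16 * ‖S‖ := by
    nth_rw 1 [S.norm_eq_iSup_rayleighQuotient hT]
    exact ciSup_le hray
  calc |inner ℝ (T x) x| ≤ ‖S x‖ * ‖x‖ := abs_real_inner_le_norm _ _
    _ ≤ (‖S‖ * ‖x‖) * ‖x‖ := by gcongr; exact S.le_opNorm x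
    _ = ‖S‖ * ‖x‖ ^ 2 := by ring
    _ ≤ _ := by
        gcongr
        linarith

end QuadraticForm

/-! ### Extreme singular values and quadratic forms -/

section SingularValues

theorem norm_sq_eq_sum_inner_sq {E : Type*} [NormedAddCommGroup E] [InnerProductSpace ℝ E] {n : ℕ}
    (b : OrthonormalBasis (Fin n) ℝ E) (x : E) :
    ‖x‖ ^ 2 = ∑ i, (inner ℝ (b i) x) ^ 2 := by
  rw [← b.sum_sq_norm_inner_right x]
  simp

variable {E : Type*} [NormedAddCommGroup E] [InnerProductSpace ℝ E] [FiniteDimensional ℝ E]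

theorem LinearMap.IsSymmetric.inner_apply_self_eq_sum {T : E →ₗ[ℝ] E} (hT : T.IsSymmetric) {n : ℕ}
    (hn : Module.finrank ℝ E = n) (x : E) :
    inner ℝ (T x) x
      = ∑ i, hT.eigenvalues hn i * (inner ℝ (hT.eigenvectorBasis hn i) x) ^ 2 := by
  rw [← OrthonormalBasis.sum_inner_mul_inner (hT.eigenvectorBasis hn) (T x) x]
  refine Finset.sum_congr rfl fun i _ => ?_
  rw [hT x, hT.apply_eigenvectorBasis, real_inner_comm]
  simp only [RCLike.ofReal_real_eq_id, id_eq, inner_smul_left, RCLike.conj_to_real]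
  ring

theorem LinearMap.norm_sq_apply_eq_sum (T : E →ₗ[ℝ] E) {n : ℕ} (hn : Module.finrank ℝ E = n)
    (x : E) : ‖T x‖ ^ 2 = ∑ i : Fin n, T.singularValues i ^ 2 *
      (inner ℝ (T.isSymmetric_adjoint_comp_self.eigenvectorBasis hn i) x) ^ 2 := by
  simp only [T.sq_singularValues_fin hn]
  rw [← T.isSymmetric_adjoint_comp_self.inner_apply_self_eq_sum hn x, LinearMap.comp_apply,
    LinearMap.adjoint_inner_left, real_inner_self_eq_norm_sq]

theorem LinearMap.norm_apply_le_singularValues_zero (T : E →ₗ[ℝ] E) (x : E) :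
    ‖T x‖ ≤ T.singularValues 0 * ‖x‖ := by
  apply le_of_sq_le_sq _ (mul_nonneg (T.singularValues_nonneg 0) (norm_nonneg x))
  rw [T.norm_sq_apply_eq_sum rfl, mul_pow,
    norm_sq_eq_sum_inner_sq (T.isSymmetric_adjoint_comp_self.eigenvectorBasis rfl), Finset.mul_sum]
  refine Finset.sum_le_sum fun i _ => ?_
  have := T.singularValues_nonneg i
  have := T.singularValues_antitone (Nat.zero_le i)
  gcongr

theorem LinearMap.singularValues_last_le_norm_apply (T : E →ₗ[ℝ] E) {n : ℕ}
    (hn : Module.finrank ℝ E = n) (x : E) :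
    T.singularValues (n - 1) * ‖x‖ ≤ ‖T x‖ := by
  apply le_of_sq_le_sq _ (norm_nonneg _)
  rw [T.norm_sq_apply_eq_sum hn, mul_pow,
    norm_sq_eq_sum_inner_sq (T.isSymmetric_adjoint_comp_self.eigenvectorBasis hn), Finset.mul_sum]
  refine Finset.sum_le_sum fun i _ => ?_
  have := T.singularValues_nonneg (n - 1)
  have := T.singularValues_antitone (show (i : ℕ) ≤ n - 1 by omega)
  gcongr

/-- Each eigenvalue of a positive `T` is the norm of `T` at a unit eigenvector, hence at least the
last singular value; the two spectra need not be matched. -/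
theorem LinearMap.IsPositive.singularValues_last_mul_le {T : E →ₗ[ℝ] E} (hT : T.IsPositive) {n : ℕ}
    (hn : Module.finrank ℝ E = n) (x : E) :
    T.singularValues (n - 1) * ‖x‖ ^ 2 ≤ inner ℝ (T x) x := by
  have hs := hT.isSymmetric
  rw [hs.inner_apply_self_eq_sum hn, norm_sq_eq_sum_inner_sq (hs.eigenvectorBasis hn),
    Finset.mul_sum]
  refine Finset.sum_le_sum fun i _ => ?_
  have h := T.singularValues_last_le_norm_apply hn (hs.eigenvectorBasis hn i)
  rw [hs.apply_eigenvectorBasis, norm_smul, (hs.eigenvectorBasis hn).orthonormal.1 i, mul_one,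
    mul_one, RCLike.norm_ofReal, abs_of_nonneg (hT.nonneg_eigenvalues hn i)] at h
  gcongr

end SingularValues

theorem inner_toEuclideanLin_self {p : ℕ} (M : Matrix (Fin p) (Fin p) ℝ) (x : Fin p → ℝ) :
    inner ℝ (Matrix.toEuclideanLin M (WithLp.toLp 2 x)) (WithLp.toLp 2 x) = x ⬝ᵥ (M *ᵥ x) := by
  simp [PiLp.inner_apply, dotProduct]

theorem norm_toLp_sq {ι : Type*} [Fintype ι] (x : ι → ℝ) : ‖WithLp.toLp 2 x‖ ^ 2 = x ⬝ᵥ x := by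
  rw [EuclideanSpace.real_norm_sq_eq]
  simp [dotProduct, sq]

theorem sigmaMax_nonneg {m n : ℕ} (M : Matrix (Fin m) (Fin n) ℝ) : 0 ≤ sigmaMax M :=
  LinearMap.singularValues_nonneg _ _

theorem dotProduct_mulVec_le_sigmaMax {p : ℕ} (M : Matrix (Fin p) (Fin p) ℝ) (x : Fin p → ℝ) :
    x ⬝ᵥ (M *ᵥ x) ≤ sigmaMax M * (x ⬝ᵥ x) := by
  rw [← inner_toEuclideanLin_self, ← norm_toLp_sq, sq, ← mul_assoc]
  refine (real_inner_le_norm _ _).trans ?_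
  gcongr
  exact LinearMap.norm_apply_le_singularValues_zero _ _

theorem Matrix.PosDef.sigmaMin_mul_le {p : ℕ} {M : Matrix (Fin p) (Fin p) ℝ} (hM : M.PosDef)
    (x : Fin p → ℝ) : sigmaMin M * (x ⬝ᵥ x) ≤ x ⬝ᵥ (M *ᵥ x) := by
  rw [← inner_toEuclideanLin_self, ← norm_toLp_sq, sigmaMin, min_self]
  exact (Matrix.isPositive_toEuclideanLin_iff.2 hM.posSemidef).singularValues_last_mul_le
    (by simp) _

/-- Strict positivity keeps the numerators of the final bound nonzero, so that a zero denominator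
gives `∞`; in `[0, ∞]`, `0 / 0 = 0`. -/
theorem Matrix.PosDef.sigmaMax_pos {p : ℕ} (hp : 1 ≤ p) {M : Matrix (Fin p) (Fin p) ℝ}
    (hM : M.PosDef) : 0 < sigmaMax M := by
  have h1 := hM.dotProduct_mulVec_pos (x := fun _ => 1)
    (fun h => one_ne_zero (congrFun h ⟨0, hp⟩))
  have h2 := dotProduct_mulVec_le_sigmaMax M (fun _ => 1)
  rw [star_trivial] at h1
  refine (sigmaMax_nonneg M).lt_of_ne fun h => ?_
  rw [← h, zero_mul] at h2
  linarith

/-! ### Concentration of the Gram matrix -/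

section Gram

variable {Ω : Type*} [MeasurableSpace Ω] {μ : Measure Ω}

theorem PsiTwoBound.memLp_two {z : Ω → ℝ} {r : ℝ} (hz : AEMeasurable z μ)
    (h : PsiTwoBound z μ r) : MemLp z 2 μ := by
  rw [memLp_two_iff_integrable_sq hz.aestronglyMeasurable]
  have hi : Integrable (fun ω => z ω ^ 2 / r ^ 2) μ :=
    integrable_of_lintegral_exp_le_two ((hz.pow_const 2).div_const _)
      (fun ω => by positivity) h.2
  have hr : r ^ 2 ≠ 0 := (pow_pos h.1 2).ne'
  refine (hi.mul_const (r ^ 2)).congr (ae_of_all _ fun ω => ?_)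
  exact div_mul_cancel₀ _ hr

theorem integral_dotProduct_sq {p : ℕ} {X : Ω → Fin p → ℝ} {M : Matrix (Fin p) (Fin p) ℝ}
    (hX : ∀ j, MemLp (fun ω => X ω j) 2 μ) (hcov : ∀ j l, ∫ ω, X ω j * X ω l ∂μ = M j l)
    (w : Fin p → ℝ) : ∫ ω, (w ⬝ᵥ X ω) ^ 2 ∂μ = w ⬝ᵥ (M *ᵥ w) := by
  have hint : ∀ j l, Integrable (fun ω => w j * w l * (X ω j * X ω l)) μ := fun j l =>
    ((hX j).integrable_mul (hX l)).const_mul _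
  have e : ∀ ω, (w ⬝ᵥ X ω) ^ 2 = ∑ j, ∑ l, w j * w l * (X ω j * X ω l) := by
    intro ω
    rw [sq, dotProduct, Finset.sum_mul_sum]
    refine Finset.sum_congr rfl fun j _ => Finset.sum_congr rfl fun l _ => ?_
    ring
  simp_rw [e]
  rw [integral_finsetSum _ fun j _ => integrable_finsetSum _ fun l _ => hint j l]
  simp only [dotProduct, Matrix.mulVec, Finset.mul_sum]
  refine Finset.sum_congr rfl fun j _ => ?_
  rw [integral_finsetSum _ fun l _ => hint j l]
  refine Finset.sum_congr rfl fun l _ => ?_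
  rw [integral_const_mul, hcov]
  ring

variable [IsProbabilityMeasure μ]

theorem measureReal_sum_sq_deviation_le {n : ℕ} {z : Fin n → Ω → ℝ} (hind : iIndepFun z μ)
    (hz : ∀ i, AEMeasurable (z i) μ) {r : ℝ} (hr : ∀ i, PsiTwoBound (z i) μ r) (hr0 : 0 < r)
    {s : ℝ} (hs : ∀ i, ∫ ω, z i ω ^ 2 ∂μ = s) {u : ℝ} (hu : 0 ≤ u) :
    μ.real {ω | 16 * n * (√u + u) * r ^ 2 ≤ |∑ i, z i ω ^ 2 - n * s|}
      ≤ 2 * Real.exp (-(4 * (n * u))) := by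
  have hr2 : 0 < r ^ 2 := pow_pos hr0 2
  have hind' : iIndepFun (fun i ω => z i ω ^ 2 / r ^ 2) μ :=
    hind.comp (fun _ x => x ^ 2 / r ^ 2) fun _ => by fun_prop
  have h := bernstein_two_sided hind' (fun i => ((hz i).pow_const 2).div_const _)
    (fun i ω => by positivity) (fun i => (hr i).2) hu
  convert h using 3
  simp_rw [integral_div, hs, ← Finset.sum_div, Finset.sum_const, Finset.card_univ,
    Fintype.card_fin, nsmul_eq_mul]
  ext ω
  rw [← sub_div, abs_div, abs_of_pos hr2, le_div_iff₀ hr2]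

/-- The factor 4 in the Bernstein exponent pays for the union bound over the net, because `25 ≤ exp
4`. -/
theorem twentyFive_pow_mul_exp_le (p : ℕ) {q : ℝ} (hq : 0 ≤ q) :
    (25 : ℝ) ^ p * (2 * Real.exp (-(4 * (p + q)))) ≤ 2 * Real.exp (-q) := by
  have h25 : (25 : ℝ) ≤ Real.exp 4 := by
    have h1 : (2.7 : ℝ) ≤ Real.exp 1 := by linarith [Real.exp_one_gt_d9]
    have h4 : Real.exp 4 = Real.exp 1 ^ 4 := by rw [← Real.exp_nat_mul]; norm_num
    rw [h4]
    calc (25 : ℝ) ≤ 2.7 ^ 4 := by norm_num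
      _ ≤ _ := by gcongr
  calc (25 : ℝ) ^ p * (2 * Real.exp (-(4 * (p + q))))
      ≤ Real.exp 4 ^ p * (2 * Real.exp (-(4 * (p + q)))) := by gcongr
    _ = 2 * Real.exp (-(4 * q)) := by
        rw [← Real.exp_nat_mul, mul_left_comm, ← Real.exp_add]
        congr 2
        ring
    _ ≤ _ := by
        gcongr
        linarith

theorem dotProduct_gram_sub_mulVec {n p : ℕ} (X : Matrix (Fin n) (Fin p) ℝ)
    (M : Matrix (Fin p) (Fin p) ℝ) (c : ℝ) (x : Fin p → ℝ) :
    x ⬝ᵥ ((Xᵀ * X - c • M) *ᵥ x) = ∑ i, (x ⬝ᵥ X i) ^ 2 - c * (x ⬝ᵥ (M *ᵥ x)) := by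
  rw [Matrix.sub_mulVec, dotProduct_sub, Matrix.smul_mulVec, dotProduct_smul, smul_eq_mul,
    ← Matrix.mulVec_mulVec, Matrix.dotProduct_mulVec, Matrix.vecMul_transpose]
  congr 1
  simp only [dotProduct, Matrix.mulVec, sq]
  refine Finset.sum_congr rfl fun i _ => ?_
  simp only [mul_comm]

/-- For i.i.d. rows with second moment matrix `M`, the Gram matrix deviates from `n M`, as a
quadratic form, by at most `C L² (√((p + q) / n) + (p + q) / n) n σ_max(M)`. -/
theorem measureReal_gram_deviation_le {n p : ℕ} (hn : 1 ≤ n) (hp : 1 ≤ p)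
    {X : Fin n → Ω → Fin p → ℝ} (hind : iIndepFun X μ)
    (hsg : ∀ i h, IsSubGaussianVar (fun ω => h ⬝ᵥ X i ω) μ) {M : Matrix (Fin p) (Fin p) ℝ}
    (hM : M.PosDef) (hcov : ∀ i j l, ∫ ω, X i ω j * X i ω l ∂μ = M j l) {L : ℝ} (hL : 1 ≤ L)
    (hpsi : ∀ i h, psiTwoNorm (fun ω => h ⬝ᵥ X i ω) μ ≤ L * √(h ⬝ᵥ (M *ᵥ h)))
    {q : ℝ} (hq : 0 ≤ q) :
    μ.real {ω | ∃ x : Fin p → ℝ,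
        1024 / 7 * L ^ 2 * (√((p + q) / n) + (p + q) / n) * (n * sigmaMax M) * (x ⬝ᵥ x)
          < |∑ i, (x ⬝ᵥ X i ω) ^ 2 - n * (x ⬝ᵥ (M *ᵥ x))|} ≤ 2 * Real.exp (-q) := by
  obtain ⟨N, hNcard, hNnorm, hNcov⟩ :=
    exists_quarter_net_unitBall (E := EuclideanSpace ℝ (Fin p))
  rw [finrank_euclideanSpace_fin] at hNcard
  have hσ : 0 < sigmaMax M := hM.sigmaMax_pos hp
  have hn0 : (0 : ℝ) < n := by exact_mod_cast hn
  set u : ℝ := (p + q) / n with hu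
  have hu0 : 0 ≤ u := by positivity
  have hnu : n * u = p + q := by rw [hu]; field_simp
  -- Net points have norm at most `3/2`, so their marginals have sub-gaussian norm at most `(3/2) L
  -- √σ_max`, strictly below `r`.
  set r : ℝ := 2 * L * √(sigmaMax M) with hr
  have hr0 : 0 < r := by positivity
  have hr2 : r ^ 2 = 4 * L ^ 2 * sigmaMax M := by
    rw [hr, mul_pow, Real.sq_sqrt hσ.le]; ring
  have hmem : ∀ i j, MemLp (fun ω => X i ω j) 2 μ := by
    intro i j
    obtain ⟨hm, s, hs⟩ := hsg i (Pi.single j 1)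
    simpa using hs.memLp_two hm
  have hpoint : ∀ c ∈ N, μ.real {ω | 16 * n * (√u + u) * r ^ 2 ≤
      |∑ i, (c.ofLp ⬝ᵥ X i ω) ^ 2 - n * (c.ofLp ⬝ᵥ (M *ᵥ c.ofLp))|}
        ≤ 2 * Real.exp (-(4 * (p + q))) := by
    intro c hc
    rw [← hnu]
    have hcc : c.ofLp ⬝ᵥ c.ofLp ≤ 9 / 4 := by
      rw [← norm_toLp_sq]
      have := hNnorm c hc
      change ‖c‖ ^ 2 ≤ 9 / 4
      nlinarith [norm_nonneg c]
    have hlt : L * √(c.ofLp ⬝ᵥ (M *ᵥ c.ofLp)) < r := by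
      have h1 : c.ofLp ⬝ᵥ (M *ᵥ c.ofLp) ≤ sigmaMax M * (9 / 4) :=
        (dotProduct_mulVec_le_sigmaMax M _).trans (by gcongr)
      have h2 : √(c.ofLp ⬝ᵥ (M *ᵥ c.ofLp)) < 2 * √(sigmaMax M) := by
        rw [Real.sqrt_lt' (by positivity), mul_pow, Real.sq_sqrt hσ.le]
        linarith
      rw [hr, mul_comm 2 L, mul_assoc]
      gcongr
    refine measureReal_sum_sq_deviation_le (z := fun i ω => c.ofLp ⬝ᵥ X i ω) ?_
      (fun i => (hsg i _).1) (fun i => ?_) hr0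
      (fun i => integral_dotProduct_sq (hmem i) (hcov i) _) hu0
    · exact hind.comp (fun _ y => c.ofLp ⬝ᵥ y) fun _ => by unfold dotProduct; fun_prop
    · exact (hsg i _).psiTwoBound_of_norm_lt ((hpsi i _).trans_lt hlt)
  have hsub : {ω | ∃ x : Fin p → ℝ,
      1024 / 7 * L ^ 2 * (√u + u) * (n * sigmaMax M) * (x ⬝ᵥ x)
        < |∑ i, (x ⬝ᵥ X i ω) ^ 2 - n * (x ⬝ᵥ (M *ᵥ x))|} ⊆
      ⋃ c ∈ N, {ω | 16 * n * (√u + u) * r ^ 2 ≤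
        |∑ i, (c.ofLp ⬝ᵥ X i ω) ^ 2 - n * (c.ofLp ⬝ᵥ (M *ᵥ c.ofLp))|} := by
    rintro ω ⟨x, hx⟩
    by_contra hω
    simp only [Set.mem_iUnion, Set.mem_ofPred_eq, exists_prop, not_exists, not_and, not_le] at hω
    set A : Matrix (Fin n) (Fin p) ℝ := Matrix.of fun i => X i ω with hA
    have hsymm : (Matrix.toEuclideanLin (Aᵀ * A - (n : ℝ) • M)).IsSymmetric := by
      rw [Matrix.isSymmetric_toEuclideanLin_iff, Matrix.IsHermitian,
        Matrix.conjTranspose_eq_transpose_of_trivial, Matrix.transpose_sub, Matrix.transpose_mul,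
        Matrix.transpose_transpose, Matrix.transpose_smul,
        ← Matrix.conjTranspose_eq_transpose_of_trivial M, hM.isHermitian.eq]
    have h := hsymm.abs_inner_le_of_net hNcov (δ := 16 * n * (√u + u) * r ^ 2)
      (fun c hc => by
        have h1 := dotProduct_gram_sub_mulVec A M n c.ofLp
        rw [← inner_toEuclideanLin_self, WithLp.toLp_ofLp] at h1
        rw [h1]
        exact (hω c hc).le) (WithLp.toLp 2 x)
    rw [inner_toEuclideanLin_self, norm_toLp_sq, dotProduct_gram_sub_mulVec, hr2] at h
    -- The constant is `1024/7 = (16/7) * 16 * 4`: net, Bernstein, `r ^ 2`.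
    refine hx.not_ge (h.trans (le_of_eq ?_))
    ring
  calc _ ≤ μ.real _ := measureReal_mono hsub (measure_ne_top _ _)
    _ ≤ ∑ c ∈ N, μ.real _ := measureReal_biUnion_finset_le _ _
    _ ≤ ∑ c ∈ N, 2 * Real.exp (-(4 * (p + q))) := Finset.sum_le_sum hpoint
    _ = (N.card : ℝ) * (2 * Real.exp (-(4 * (p + q)))) := by
        rw [Finset.sum_const, nsmul_eq_mul]
    _ ≤ (25 : ℝ) ^ p * (2 * Real.exp (-(4 * (p + q)))) := by
        gcongr
        exact_mod_cast hNcard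
    _ ≤ _ := twentyFive_pow_mul_exp_le p hq

end Gram

/-! ### Spectral norms of block matrices and pseudoinverses -/

section Spectral

theorem norm_toLp_mulVec_le {m n : Type*} [Fintype m] [Fintype n] [DecidableEq n]
    (M : Matrix m n ℝ) (x : n → ℝ) :
    ‖WithLp.toLp 2 (M *ᵥ x)‖ ≤ ‖M‖ * ‖WithLp.toLp 2 x‖ :=
  Matrix.l2_opNorm_mulVec M (WithLp.toLp 2 x)

theorem l2_opNorm_sq_le {m n : Type*} [Fintype m] [Fintype n] [DecidableEq n]
    {M : Matrix m n ℝ} {c : ℝ} (hc : 0 ≤ c)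
    (h : ∀ x, (M *ᵥ x) ⬝ᵥ (M *ᵥ x) ≤ c * (x ⬝ᵥ x)) : ‖M‖ ^ 2 ≤ c := by
  have : ‖M‖ ≤ √c := by
    rw [Matrix.l2_opNorm_def]
    refine ContinuousLinearMap.opNorm_le_bound _ (Real.sqrt_nonneg c) fun x => ?_
    apply le_of_sq_le_sq _ (by positivity)
    rw [mul_pow, Real.sq_sqrt hc]
    have := h x.ofLp
    rw [← norm_toLp_sq, ← norm_toLp_sq] at this
    exact this
  calc ‖M‖ ^ 2 ≤ √c ^ 2 := by gcongr
    _ = c := Real.sq_sqrt hc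

/-- The C*-identity reads `‖P‖ = ‖P‖ ^ 2`. -/
theorem l2_opNorm_le_one_of_isProj {n : Type*} [Fintype n] [DecidableEq n] {P : Matrix n n ℝ}
    (hs : Pᵀ = P) (hi : P * P = P) : ‖P‖ ≤ 1 := by
  have h := Matrix.l2_opNorm_conjTranspose_mul_self P
  rw [Matrix.conjTranspose_eq_transpose_of_trivial, hs, hi] at h
  nlinarith [norm_nonneg P, sq_nonneg (‖P‖ - 1)]

theorem l2_opNorm_one_le {n : Type*} [Fintype n] [DecidableEq n] :
    ‖(1 : Matrix n n ℝ)‖ ≤ 1 :=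
  l2_opNorm_le_one_of_isProj Matrix.transpose_one (one_mul 1)

theorem IsMoorePenrose.norm_mul_self_le_one {m n : Type*} [Fintype m] [Fintype n] [DecidableEq n]
    {A : Matrix m n ℝ} {X : Matrix n m ℝ} (h : IsMoorePenrose A X) : ‖X * A‖ ≤ 1 :=
  l2_opNorm_le_one_of_isProj h.2.2.2 (by rw [← Matrix.mul_assoc, h.2.1])

/-- Taking `x = X y` gives `c ‖X y‖² ≤ ‖A X y‖² ≤ ‖y‖²`, because `A X` is an orthogonal projection.
-/
theorem IsMoorePenrose.norm_sq_le {m n : Type*} [Fintype m] [Fintype n] [DecidableEq m]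
    {A : Matrix m n ℝ} {X : Matrix n m ℝ} (h : IsMoorePenrose A X) {c : ℝ} (hc : 0 < c)
    (hA : ∀ x, c * (x ⬝ᵥ x) ≤ (A *ᵥ x) ⬝ᵥ (A *ᵥ x)) : ‖X‖ ^ 2 ≤ c⁻¹ := by
  have hP : ‖A * X‖ ≤ 1 :=
    l2_opNorm_le_one_of_isProj h.2.2.1 (by rw [← Matrix.mul_assoc, h.1])
  refine l2_opNorm_sq_le (inv_nonneg.2 hc.le) fun y => ?_
  have h1 := hA (X *ᵥ y)
  have h2 := norm_toLp_mulVec_le (A * X) y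
  have h3 : ((A * X) *ᵥ y) ⬝ᵥ ((A * X) *ᵥ y) ≤ y ⬝ᵥ y := by
    rw [← norm_toLp_sq, ← norm_toLp_sq]
    gcongr
    exact h2.trans (mul_le_of_le_one_left (norm_nonneg _) hP)
  rw [Matrix.mulVec_mulVec] at h1
  rw [inv_mul_eq_div, le_div_iff₀' hc]
  exact h1.trans h3

/-- Triangle inequality within each block row, then Cauchy–Schwarz over the block columns. -/
theorem l2_opNorm_sq_le_sum_blocks {K : ℕ} {p : Fin K → ℕ}
    (M : Matrix (BlockIdx p) (BlockIdx p) ℝ) :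
    ‖M‖ ^ 2 ≤ ∑ k, ∑ i, ‖M.submatrix (fun j : Fin (p k) => (⟨k, j⟩ : BlockIdx p))
      (fun l : Fin (p i) => (⟨i, l⟩ : BlockIdx p))‖ ^ 2 := by
  refine l2_opNorm_sq_le (by positivity) fun x => ?_
  let b : ∀ k i, Matrix (Fin (p k)) (Fin (p i)) ℝ := fun k i =>
    M.submatrix (fun j => ⟨k, j⟩) (fun l => ⟨i, l⟩)
  let y : ∀ i, Fin (p i) → ℝ := fun i l => x ⟨i, l⟩
  have hx : x ⬝ᵥ x = ∑ i, ‖WithLp.toLp 2 (y i)‖ ^ 2 := by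
    simp only [norm_toLp_sq, dotProduct, Fintype.sum_sigma, y]
  have hMx : (M *ᵥ x) ⬝ᵥ (M *ᵥ x) = ∑ k, ‖∑ i, WithLp.toLp 2 (b k i *ᵥ y i)‖ ^ 2 := by
    have e : ∀ k, (∑ i, WithLp.toLp 2 (b k i *ᵥ y i))
        = WithLp.toLp 2 (fun j => (M *ᵥ x) ⟨k, j⟩) := by
      intro k
      ext j
      simp [Matrix.mulVec, dotProduct, Fintype.sum_sigma, b, y]
    simp only [e, norm_toLp_sq]
    simp only [dotProduct, Fintype.sum_sigma]
  rw [hMx, hx, Finset.sum_mul]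
  refine Finset.sum_le_sum fun k _ => ?_
  calc ‖∑ i, WithLp.toLp 2 (b k i *ᵥ y i)‖ ^ 2
      ≤ (∑ i, ‖b k i‖ * ‖WithLp.toLp 2 (y i)‖) ^ 2 := by
        gcongr
        exact norm_sum_le_of_le _ fun i _ => norm_toLp_mulVec_le _ _
    _ ≤ _ := Finset.sum_mul_sq_le_sq_mul_sq _ _ _

theorem ofReal_norm_iterMatrix_le {n K : ℕ} {p : Fin K → ℕ} (hK : 1 ≤ K)
    (A : Matrix (Fin n) (BlockIdx p) ℝ) {U m : Fin K → ℝ} (hU0 : ∀ k, 0 < U k)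
    (hU : ∀ k x, (colBlock A k *ᵥ x) ⬝ᵥ (colBlock A k *ᵥ x) ≤ U k * (x ⬝ᵥ x))
    (hm : ∀ k x, m k * (x ⬝ᵥ x) ≤ (colBlock A k *ᵥ x) ⬝ᵥ (colBlock A k *ᵥ x)) :
    ENNReal.ofReal ‖iterMatrix A‖ ≤ 1 + 1 / (K : ℝ≥0∞) *
      ((K : ℝ≥0∞) + ∑ k : Fin K, ∑ i ∈ Finset.univ.filter (fun i : Fin K => i ≠ k),
        ENNReal.ofReal (U k) / ENNReal.ofReal (max 0 (m i))) ^ (1 / 2 : ℝ) := by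
  have hK0 : (0 : ℝ) < K := by exact_mod_cast hK
  set f : Fin K → Fin K → ℝ := fun i k => ‖pinv (colBlock A i) * colBlock A k‖ ^ 2 with hf
  have hdiag : ∀ k, ENNReal.ofReal (f k k) ≤ 1 := fun k =>
    ENNReal.ofReal_le_one.2
      (pow_le_one₀ (norm_nonneg _) (pinv_spec (colBlock A k)).norm_mul_self_le_one)
  have hoff : ∀ i k, ENNReal.ofReal (f i k)
      ≤ ENNReal.ofReal (U k) / ENNReal.ofReal (max 0 (m i)) := by
    intro i k
    rcases le_or_gt (m i) 0 with h | h
    · rw [max_eq_left h, ENNReal.ofReal_zero,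
        ENNReal.div_zero (ENNReal.ofReal_pos.2 (hU0 k)).ne']
      exact le_top
    · rw [max_eq_right h.le, ← ENNReal.ofReal_div_of_pos h]
      apply ENNReal.ofReal_le_ofReal
      have h1 := (pinv_spec (colBlock A i)).norm_sq_le h (hm i)
      have h2 := l2_opNorm_sq_le (hU0 k).le (hU k)
      calc f i k ≤ (‖pinv (colBlock A i)‖ * ‖colBlock A k‖) ^ 2 := by
            simp only [hf]
            gcongr
            exact Matrix.l2_opNorm_mul _ _
        _ ≤ (m i)⁻¹ * U k := by rw [mul_pow]; gcongr
        _ = _ := by rw [inv_mul_eq_div]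
  have hblocks : ‖stackedPinv A * A‖ ^ 2 ≤ ∑ k, ∑ i, f i k := by
    rw [Finset.sum_comm]
    -- The blocks of `stackedPinv A * A` are the products `A_i⁺ A_k` by definition.
    exact l2_opNorm_sq_le_sum_blocks (stackedPinv A * A)
  have hsum : ENNReal.ofReal (‖stackedPinv A * A‖ ^ 2) ≤
      (K : ℝ≥0∞) + ∑ k : Fin K, ∑ i ∈ Finset.univ.filter (fun i : Fin K => i ≠ k),
        ENNReal.ofReal (U k) / ENNReal.ofReal (max 0 (m i)) := by
    have hf0 : ∀ i k, 0 ≤ f i k := fun i k => sq_nonneg _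
    have hKsum : (K : ℝ≥0∞) = ∑ _k : Fin K, 1 := by simp
    refine (ENNReal.ofReal_le_ofReal hblocks).trans ?_
    rw [ENNReal.ofReal_sum_of_nonneg fun k _ => Finset.sum_nonneg fun i _ => hf0 i k, hKsum,
      ← Finset.sum_add_distrib]
    refine Finset.sum_le_sum fun k _ => ?_
    rw [ENNReal.ofReal_sum_of_nonneg fun i _ => hf0 i k, Finset.filter_ne',
      ← Finset.add_sum_erase _ _ (Finset.mem_univ k)]
    exact add_le_add (hdiag k) (Finset.sum_le_sum fun i _ => hoff i k)
  have hB : ‖iterMatrix A‖ ≤ 1 + 1 / K * ‖stackedPinv A * A‖ := by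
    refine (norm_sub_le _ _).trans (add_le_add l2_opNorm_one_le ?_)
    rw [norm_smul, Real.norm_of_nonneg (by positivity)]
  refine (ENNReal.ofReal_le_ofReal hB).trans ?_
  rw [ENNReal.ofReal_add zero_le_one (by positivity), ENNReal.ofReal_one,
    ENNReal.ofReal_mul (by positivity), ENNReal.ofReal_div_of_pos hK0, ENNReal.ofReal_one,
    ENNReal.ofReal_natCast]
  gcongr
  rw [← Real.sqrt_sq (norm_nonneg (stackedPinv A * A)), Real.sqrt_eq_rpow,
    ← ENNReal.ofReal_rpow_of_nonneg (sq_nonneg _) (by norm_num)]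
  gcongr

end Spectral

/-! ### Union bound over the blocks. -/

theorem sum_dotProduct_sq_eq {n p : ℕ} (A : Matrix (Fin n) (Fin p) ℝ) (x : Fin p → ℝ) :
    ∑ i, (x ⬝ᵥ A i) ^ 2 = (A *ᵥ x) ⬝ᵥ (A *ᵥ x) := by
  simp only [dotProduct, Matrix.mulVec, sq]
  refine Finset.sum_congr rfl fun i _ => ?_
  simp only [mul_comm]

/-- Marginals of a block are marginals of the whole vector. -/
theorem exists_dotProduct_eq_block {K : ℕ} {p : Fin K → ℕ} (k : Fin K) (h : Fin (p k) → ℝ) :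
    ∃ h' : BlockIdx p → ℝ, ∀ v : BlockIdx p → ℝ, v ⬝ᵥ h' = h ⬝ᵥ fun j => v ⟨k, j⟩ := by
  refine ⟨fun r => ∑ j, if r = ⟨k, j⟩ then h j else 0, fun v => ?_⟩
  simp only [dotProduct, Finset.mul_sum]
  rw [Finset.sum_comm]
  simp [mul_comm]

/-- The norm `‖·‖` of a matrix is the spectral norm (scoped `L2Operator` instance); `A` has the
random vectors `a i` as its rows. -/
theorem theorem4 :
    ∃ C : ℝ, 0 < C ∧
      ∀ (n K : ℕ) (p : Fin K → ℕ), 1 ≤ K → (∀ k, 1 ≤ p k) → (∀ k, p k ≤ n) →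
      ∀ (S : Matrix (BlockIdx p) (BlockIdx p) ℝ), S.PosDef →
      ∀ (Ω : Type*) [MeasurableSpace Ω] (μ : Measure Ω) [IsProbabilityMeasure μ]
        (a : Fin n → Ω → BlockIdx p → ℝ),
        iIndepFun a μ →
        (∀ i j, IdentDistrib (a i) (a j) μ μ) →
        (∀ i, IsCenteredSubGaussianVec (a i) S μ) →
      ∀ (L : Fin K → ℝ), (∀ k, 1 ≤ L k) →
        (∀ (k : Fin K) (i : Fin n) (h : Fin (p k) → ℝ),
          psiTwoNorm (fun ω => h ⬝ᵥ (fun j => a i ω ⟨k, j⟩)) μ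
            ≤ L k * √(h ⬝ᵥ (diagBlock S k *ᵥ h))) →
      ∀ (q : Fin K → ℝ), (∀ k, 0 ≤ q k) →
        1 - ∑ k, 2 * Real.exp (-(q k)) ≤
          μ.real {ω | ENNReal.ofReal
              ‖iterMatrix (Matrix.of fun i => a i ω : Matrix (Fin n) (BlockIdx p) ℝ)‖
                ≤ betaBound C n S L q} := by
  refine ⟨1024 / 7, by norm_num, ?_⟩
  intro n K p hK hp hpn S hS Ω _ μ _ a hind hid ha L hL hpsi q hq
  have hn : 1 ≤ n := (hp ⟨0, hK⟩).trans (hpn ⟨0, hK⟩)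
  have hSk : ∀ k, (diagBlock S k).PosDef := fun k =>
    hS.submatrix fun _ _ h => by simpa using h
  set bad : Fin K → Set Ω := fun k => {ω | ∃ x : Fin (p k) → ℝ,
    ellBlock (1024 / 7) n S L q k * (x ⬝ᵥ x) <
      |∑ i, (x ⬝ᵥ fun j => a i ω ⟨k, j⟩) ^ 2 - n * (x ⬝ᵥ (diagBlock S k *ᵥ x))|} with hbaddef
  have hbad : ∀ k, μ.real (bad k) ≤ 2 * Real.exp (-(q k)) := fun k =>
    measureReal_gram_deviation_le (X := fun i ω j => a i ω ⟨k, j⟩) hn (hp k)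
      (hind.comp (fun _ v j => v ⟨k, j⟩) fun _ => by fun_prop)
      (fun i h => by
        obtain ⟨h', hh'⟩ := exists_dotProduct_eq_block k h
        have := (ha i).subGaussian h'
        simpa only [hh'] using this)
      (hSk k) (fun i j l => (ha i).covariance _ _) (hL k) (fun i h => hpsi k i h) (hq k)
  set good : Set Ω := {ω | ENNReal.ofReal
    ‖iterMatrix (Matrix.of fun i => a i ω : Matrix (Fin n) (BlockIdx p) ℝ)‖
      ≤ betaBound (1024 / 7) n S L q} with hgood
  -- Covering the whole space needs only monotonicity and subadditivity of `μ`, so no event has to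
  -- be shown measurable.
  have hcover : Set.univ ⊆ good ∪ ⋃ k, bad k := by
    intro ω _
    by_cases hω : ω ∈ ⋃ k, bad k
    · exact Or.inr hω
    refine Or.inl ?_
    have hdev : ∀ k (x : Fin (p k) → ℝ),
        |(colBlock (Matrix.of fun i => a i ω) k *ᵥ x) ⬝ᵥ
            (colBlock (Matrix.of fun i => a i ω) k *ᵥ x) - n * (x ⬝ᵥ (diagBlock S k *ᵥ x))|
          ≤ ellBlock (1024 / 7) n S L q k * (x ⬝ᵥ x) := by
      intro k x
      rw [← sum_dotProduct_sq_eq]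
      by_contra! hlt
      exact hω (Set.mem_iUnion.2 ⟨k, x, hlt⟩)
    have hell : ∀ k, 0 ≤ ellBlock (1024 / 7) n S L q k := fun k => by
      have := sigmaMax_nonneg (diagBlock S k)
      have := hq k
      unfold ellBlock
      positivity
    refine ofReal_norm_iterMatrix_le hK _ (fun k => ?_) (fun k x => ?_) (fun k x => ?_)
    · have h1 := (hSk k).sigmaMax_pos (hp k)
      have h2 : (0 : ℝ) < n := by exact_mod_cast hn
      have := hell k
      positivity
    · have h1 := (abs_le.1 (hdev k x)).2
      have h2 := mul_le_mul_of_nonneg_left (dotProduct_mulVec_le_sigmaMax (diagBlock S k) x)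
        n.cast_nonneg
      linarith
    · have h1 := (abs_le.1 (hdev k x)).1
      have h2 := mul_le_mul_of_nonneg_left ((hSk k).sigmaMin_mul_le x) n.cast_nonneg
      linarith
  have h1 : (1 : ℝ) ≤ μ.real good + ∑ k, 2 * Real.exp (-(q k)) := by
    calc (1 : ℝ) = μ.real Set.univ := probReal_univ.symm
      _ ≤ μ.real (good ∪ ⋃ k, bad k) := measureReal_mono hcover
      _ ≤ μ.real good + μ.real (⋃ k, bad k) := measureReal_union_le _ _
      _ ≤ μ.real good + ∑ k, μ.real (bad k) := by
          gcongr
          exact measureReal_iUnion_fintype_le _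
      _ ≤ _ := by
          gcongr with k
          exact hbad k
  linarith
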